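/- Let $q$ be a prime power. For $n \ge 0$ let $E(q,n)$ be the set of all linear subspaces of $\mathrm{GF}(q)^n$, with the subspace metric $d_S(U,V) = \dim(U+V) - \dim(U\cap V)$. A subspace code is a nonempty subset $\mathcal{C} \subseteq E(q,n)$; its subspace covering radius is $\max_{U \in E(q,n)} \min_{V \in \mathcal{C}} d_S(U,V)$. For an integer $\rho \ge 0$ let $K_S(q,n,\rho)$ be the minimum cardinality of a subspace code in $E(q,n)$ whose subspace covering radius is at most $\rho$, and for real $\rho' \ge 0$ put $$k_S(\rho') = \liminf_{n\to\infty} \frac{\log_q K_S(q,n,\lfloor n\rho'\rfloor)}{\log_q |E(q,n)|}.$$ Then $k_S(\rho') = 1 - 2\rho'$ for $0 \le \rho' \le \tfrac12$, and $k_S(\rho') = 0$ for all $\rho' \ge \tfrac12$. -/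

import Mathlib

namespace SubspaceCode

/-- The projective space `E(q,n)`: the set of all linear subspaces of `GF(q)^n`, of every dimension,
where `F = GF(q)`. -/
abbrev ProjSpace (F : Type*) [Field F] (n : ℕ) : Type _ := Submodule F (Fin n → F)

/-- The subspace metric `dim (U + V) - dim (U ∩ V)`. (The subtraction of natural numbers does not
truncate, since `U ∩ V ⊆ U + V`.) -/
noncomputable def subspaceDist {F : Type*} [Field F] {n : ℕ} (U V : ProjSpace F n) : ℕ :=
  Module.finrank F ↥(U ⊔ V) - Module.finrank F ↥(U ⊓ V)

/-- The distance `min {d(U,V) : V ∈ C}` from a subspace to a (nonempty) code `C`. -/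
noncomputable def distToCode {F : Type*} [Field F] {n : ℕ}
    (U : ProjSpace F n) (C : Set (ProjSpace F n)) : ℕ :=
  ⨅ V : C, subspaceDist U (V : ProjSpace F n)

/-- The subspace covering radius `max {d(U,C) : U ∈ E(q,n)}` of a (nonempty) code `C`. All the
distances are at most `n`, so that the supremum is a maximum. -/
noncomputable def coveringRadius {F : Type*} [Field F] {n : ℕ} (C : Set (ProjSpace F n)) : ℕ :=
  ⨆ U : ProjSpace F n, distToCode U C

/-- `K_S(q,n,ρ)`: the minimum cardinality of a subspace code (a nonempty set of subspaces of
`GF(q)^n`) whose subspace covering radius is at most `ρ`. -/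
noncomputable def minCoveringCard (F : Type*) [Field F] (n ρ : ℕ) : ℕ :=
  sInf {m : ℕ | ∃ C : Set (ProjSpace F n), C.Nonempty ∧ coveringRadius C ≤ ρ ∧ C.ncard = m}

/-- The asymptotic rate of covering subspace codes,
`k_S(ρ') = liminf_n log_q K_S(q, n, ⌊n ρ'⌋) / log_q |E(q,n)|`, as an extended real number. -/
noncomputable def coveringRate (F : Type*) [Field F] (ρ' : ℝ) : EReal :=
  Filter.liminf
    (fun n : ℕ =>
      ((Real.logb (Nat.card F : ℝ) (minCoveringCard F n ⌊(n : ℝ) * ρ'⌋₊ : ℝ) /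
        Real.logb (Nat.card F : ℝ) (Nat.card (ProjSpace F n) : ℝ) : ℝ) : EReal))
    Filter.atTop

end SubspaceCode

/-!
Over a field with `q` elements, the number of subspaces lying between `A` and `B` and having
dimension `k` is `q ^ ((k - dim A) * (dim B - k))` up to a factor `q ^ O(n)`, and all such factors
are invisible after dividing `log_q` by `log_q |E(q,n)| ~ n² / 4`.

*Lower bound.* A ball of radius `ρ` contains at most `q ^ ((n - m) * ρ + O(n))` subspaces of
dimension `m ≤ n / 2`: such a `U` is found by choosing `I = U ∩ V` inside the centre `V`, and then
`U` above `I`. For `m = ⌊n / 2⌋`, covering the `q ^ (n² / 4 + O(n))` subspaces of dimension `m`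
takes at least `q ^ (n * (n - 2 * ρ) / 4 - O(n))` balls.

*Upper bound.* Fix `W` of dimension `ρ` and `H` of codimension `ρ`. If `dim U ≥ n / 2`, enlarge `U`
by `ρ` dimensions so that it contains `W`; if `dim U ≤ n / 2`, shrink it by `ρ` dimensions so that
it lies in `H`. Only `q ^ (n * (n - 2 * ρ) / 4 + O(n))` subspaces arise in this way.
-/

namespace SubspaceCode

open Filter Module Topology

section Fibers

variable {α β : Type*} [Finite α] {S : Set α}

theorem ncard_le_mul_ncard_of_mapsTo {T : Set β} {f : α → β} {b : ℕ} (hT : T.Finite)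
    (hf : S.MapsTo f T) (hb : ∀ t ∈ T, {a ∈ S | f a = t}.ncard ≤ b) :
    S.ncard ≤ b * T.ncard := by
  classical
  have hS : S.Finite := S.toFinite
  rw [Set.ncard_eq_toFinset_card S hS, Set.ncard_eq_toFinset_card T hT]
  refine Finset.card_le_mul_card_image_of_maps_to (f := f)
    (fun a ha => by simpa using hf (by simpa using ha)) b fun t ht => ?_
  rw [← Set.ncard_coe_finset]
  simpa using hb t (by simpa using ht)

theorem ncard_le_pow_add_of_fiber_le {f : α → ℕ} {q N e : ℕ} (hq : 1 < q)
    (hf : ∀ a ∈ S, f a ≤ N) (hb : ∀ i ≤ N, {a ∈ S | f a = i}.ncard ≤ q ^ e) :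
    S.ncard ≤ q ^ (N + e) := by
  calc S.ncard ≤ q ^ e * (Set.Iic N).ncard :=
        ncard_le_mul_ncard_of_mapsTo (Set.finite_Iic N) hf hb
    _ = q ^ e * (N + 1) := by rw [Set.ncard_eq_toFinset_card', Set.toFinset_Iic, Nat.card_Iic]
    _ ≤ q ^ e * q ^ N := Nat.mul_le_mul_left _ (Nat.lt_pow_self hq)
    _ = q ^ (N + e) := by rw [← pow_add, add_comm]

end Fibers

section Dimension

variable {F V : Type*} [DivisionRing F] [AddCommGroup V] [Module F V] [FiniteDimensional F V]

theorem exists_finrank_eq_between {A B : Submodule F V} (hAB : A ≤ B) {d : ℕ}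
    (hA : finrank F A ≤ d) (hB : d ≤ finrank F B) :
    ∃ U, A ≤ U ∧ U ≤ B ∧ finrank F U = d := by
  induction d, hA using Nat.le_induction with
  | base => exact ⟨A, le_rfl, hAB, rfl⟩
  | succ d _ ih =>
    obtain ⟨U, hAU, hUB, rfl⟩ := ih (by omega)
    have hlt : U < B := hUB.lt_of_ne (by rintro rfl; omega)
    obtain ⟨x, hxB, hxU⟩ := SetLike.exists_of_lt hlt
    exact ⟨U ⊔ Submodule.span F {x}, hAU.trans le_sup_left,
      sup_le hUB ((Submodule.span_singleton_le_iff_mem _ _).2 hxB),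
      Submodule.finrank_sup_span_singleton hxU⟩

theorem finrank_map_mkQ_of_le {A U : Submodule F V} (h : A ≤ U) :
    finrank F (U.map A.mkQ) = finrank F U - finrank F A := by
  have hrank := (A.mkQ.domRestrict U).finrank_range_add_finrank_ker
  have hker := (Submodule.comapSubtypeEquivOfLe h).finrank_eq
  rw [LinearMap.range_domRestrict, LinearMap.ker_domRestrict, Submodule.ker_mkQ] at hrank
  omega

theorem span_range_coe_eq_of_linearIndependent {U : Submodule F V} {k : ℕ} (hU : finrank F U = k)
    {s : Fin k → U} (hs : LinearIndependent F s) :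
    Submodule.span F (Set.range fun i => (s i : V)) = U := by
  have htop := hs.span_eq_top_of_card_eq_finrank' (by rw [Fintype.card_fin, hU])
  simpa [Submodule.map_span, ← Set.range_comp, Function.comp_def] using
    congrArg (Submodule.map U.subtype) htop

end Dimension

section Counting

/-- The Grassmannian: the set of all `k`-dimensional subspaces of `V`. Over `GF(q)` its cardinality
is the Gaussian binomial coefficient. Unlike `Module.Grassmannian`, `k` is the dimension, not the
codimension. -/
def grassmannian (F V : Type*) [Field F] [AddCommGroup V] [Module F V] (k : ℕ) :
    Set (Submodule F V) :=
  {U | finrank F U = k}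

variable {F V : Type*} [Field F] [Finite F] [AddCommGroup V] [Module F V] [Finite V]

/-- A linearly independent `k`-tuple is a `k`-dimensional subspace together with a basis of it. -/
theorem card_linearIndependent_eq_ncard_grassmannian_mul (k : ℕ) :
    Nat.card {s : Fin k → V // LinearIndependent F s} =
      (grassmannian F V k).ncard * ∏ i : Fin k, (Nat.card F ^ k - Nat.card F ^ i.val) := by
  have := Fintype.ofFinite F
  have := Fintype.ofFinite (grassmannian F V k)
  let forgetSpan (p : Σ U : grassmannian F V k, {s : Fin k → U.1 // LinearIndependent F s}) :
      {s : Fin k → V // LinearIndependent F s} :=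
    ⟨fun i => p.2.1 i, p.2.2.map' (Submodule.subtype _) (Submodule.ker_subtype _)⟩
  have hinj : forgetSpan.Injective := by
    rintro ⟨⟨U, hU⟩, s, hs⟩ ⟨⟨W, hW⟩, t, ht⟩ h
    have hst : (fun i => (s i : V)) = fun i => (t i : V) := congrArg Subtype.val h
    obtain rfl : U = W := by
      rw [← span_range_coe_eq_of_linearIndependent hU hs, hst,
        span_range_coe_eq_of_linearIndependent hW ht]
    obtain rfl : s = t := funext fun i => Subtype.ext (congrFun hst i)
    rfl
  have hsurj : forgetSpan.Surjective := fun ⟨s, hs⟩ =>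
    ⟨⟨⟨Submodule.span F (Set.range s), (finrank_span_eq_card hs).trans (Fintype.card_fin k)⟩,
      fun i => ⟨s i, Submodule.subset_span ⟨i, rfl⟩⟩, .of_comp (Submodule.subtype _) hs⟩, rfl⟩
  have hfiber (U : grassmannian F V k) : Nat.card {s : Fin k → U.1 // LinearIndependent F s} =
      ∏ i : Fin k, (Nat.card F ^ k - Nat.card F ^ i.val) := by
    rw [card_linearIndependent (Eq.ge U.2), U.2, Nat.card_eq_fintype_card]
  rw [← Nat.card_congr (Equiv.ofBijective forgetSpan ⟨hinj, hsurj⟩), Nat.card_sigma,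
    Finset.sum_congr rfl fun U _ => hfiber U, Finset.sum_const, Finset.card_univ, smul_eq_mul,
    ← Nat.card_eq_fintype_card, Nat.card_coe_set_eq]

theorem prod_pow_sub_pow_eq_ncard_grassmannian_mul {k : ℕ} (hk : k ≤ finrank F V) :
    ∏ i : Fin k, (Nat.card F ^ finrank F V - Nat.card F ^ i.val) =
      (grassmannian F V k).ncard * ∏ i : Fin k, (Nat.card F ^ k - Nat.card F ^ i.val) := by
  have := Fintype.ofFinite F
  rw [← card_linearIndependent_eq_ncard_grassmannian_mul, card_linearIndependent hk,
    Nat.card_eq_fintype_card]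

theorem pow_sub_mul_pow_sub_pow_le {q k n : ℕ} (hq : 0 < q) (hkn : k ≤ n) (i : ℕ) :
    q ^ (n - k) * (q ^ k - q ^ i) ≤ q ^ n - q ^ i := by
  rw [Nat.mul_sub, ← pow_add, Nat.sub_add_cancel hkn]
  exact Nat.sub_le_sub_left (Nat.le_mul_of_pos_left _ (pow_pos hq _)) _

theorem pow_sub_pow_le_pow_sub_mul {q i k n : ℕ} (hq : 1 < q) (hik : i < k) (hkn : k ≤ n) :
    q ^ n - q ^ i ≤ q ^ (n - k + 1) * (q ^ k - q ^ i) := by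
  have hle : q ^ (n - k + 1 + i) ≤ q ^ n := Nat.pow_le_pow_right (by omega) (by omega)
  have hdouble : q ^ n * 2 ≤ q ^ (n + 1) := by rw [pow_succ]; gcongr; omega
  rw [Nat.mul_sub, ← pow_add, ← pow_add, show n - k + 1 + k = n + 1 by omega]
  omega

theorem pow_le_ncard_grassmannian {k : ℕ} (hk : k ≤ finrank F V) :
    Nat.card F ^ (k * (finrank F V - k)) ≤ (grassmannian F V k).ncard := by
  have hq : 1 < Nat.card F := Finite.one_lt_card
  have hpos : 0 < ∏ i : Fin k, (Nat.card F ^ k - Nat.card F ^ i.val) :=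
    Finset.prod_pos fun i _ => Nat.sub_pos_of_lt (Nat.pow_lt_pow_right hq i.2)
  refine le_of_mul_le_mul_right ?_ hpos
  rw [← prod_pow_sub_pow_eq_ncard_grassmannian_mul hk, mul_comm k, pow_mul]
  simpa [Finset.prod_mul_distrib] using Finset.prod_le_prod' (s := Finset.univ)
    fun (i : Fin k) _ => pow_sub_mul_pow_sub_pow_le (one_pos.trans hq) hk i.val

theorem ncard_grassmannian_le (k : ℕ) :
    (grassmannian F V k).ncard ≤ Nat.card F ^ (k * (finrank F V - k + 1)) := by
  have hq : 1 < Nat.card F := Finite.one_lt_card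
  rcases lt_or_ge (finrank F V) k with hk | hk
  · have hempty : grassmannian F V k = ∅ := Set.eq_empty_of_forall_notMem fun U hU =>
      (hk.trans_eq hU.symm).not_ge (Submodule.finrank_le U)
    simp [hempty]
  have hpos : 0 < ∏ i : Fin k, (Nat.card F ^ k - Nat.card F ^ i.val) :=
    Finset.prod_pos fun i _ => Nat.sub_pos_of_lt (Nat.pow_lt_pow_right hq i.2)
  refine le_of_mul_le_mul_right ?_ hpos
  rw [← prod_pow_sub_pow_eq_ncard_grassmannian_mul hk, mul_comm k, pow_mul]
  simpa [Finset.prod_mul_distrib] using Finset.prod_le_prod' (s := Finset.univ)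
    fun (i : Fin k) _ => pow_sub_pow_le_pow_sub_mul hq i.2 hk

theorem ncard_Ici_inter_grassmannian_le (A : Submodule F V) (k : ℕ) :
    (Set.Ici A ∩ grassmannian F V k).ncard ≤
      Nat.card F ^ ((k - finrank F A) * (finrank F V - k + 1)) := by
  have hq : 1 < Nat.card F := Finite.one_lt_card
  have := Finite.of_surjective _ A.mkQ_surjective
  have hmaps : Set.MapsTo (Submodule.map A.mkQ) (Set.Ici A ∩ grassmannian F V k)
      (grassmannian F (V ⧸ A) (k - finrank F A)) := by
    rintro U ⟨hAU, rfl⟩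
    exact finrank_map_mkQ_of_le hAU
  have hinj : Set.InjOn (Submodule.map A.mkQ) (Set.Ici A ∩ grassmannian F V k) := by
    rintro U ⟨hAU, -⟩ W ⟨hAW, -⟩ h
    simpa [Submodule.comap_map_mkQ, sup_eq_right.2 (Set.mem_Ici.1 hAU),
      sup_eq_right.2 (Set.mem_Ici.1 hAW)] using congrArg (Submodule.comap A.mkQ) h
  refine (Set.ncard_le_ncard_of_injOn _ hmaps hinj).trans ((ncard_grassmannian_le _).trans ?_)
  have hdim := A.finrank_quotient_add_finrank
  exact Nat.pow_le_pow_right (by omega) (Nat.mul_le_mul_left _ (by omega))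

theorem ncard_Icc_inter_grassmannian_le (A B : Submodule F V) (k : ℕ) :
    (Set.Icc A B ∩ grassmannian F V k).ncard ≤
      Nat.card F ^ ((k - finrank F A) * (finrank F B - k + 1)) := by
  rcases Set.eq_empty_or_nonempty (Set.Icc A B ∩ grassmannian F V k) with h | ⟨_, hAB, -⟩
  · simp [h]
  have hmaps : Set.MapsTo (Submodule.comap B.subtype) (Set.Icc A B ∩ grassmannian F V k)
      (Set.Ici (A.comap B.subtype) ∩ grassmannian F B k) := by
    rintro U ⟨⟨hAU, hUB⟩, rfl⟩
    exact ⟨Submodule.comap_mono hAU, (Submodule.comapSubtypeEquivOfLe hUB).finrank_eq⟩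
  have hinj : Set.InjOn (Submodule.comap B.subtype) (Set.Icc A B ∩ grassmannian F V k) := by
    rintro U ⟨⟨-, hUB⟩, -⟩ W ⟨⟨-, hWB⟩, -⟩ h
    simpa [Submodule.map_comap_subtype, inf_eq_right.2 hUB, inf_eq_right.2 hWB] using
      congrArg (Submodule.map B.subtype) h
  refine (Set.ncard_le_ncard_of_injOn _ hmaps hinj).trans
    ((ncard_Ici_inter_grassmannian_le _ _).trans_eq ?_)
  rw [(Submodule.comapSubtypeEquivOfLe (hAB.1.trans hAB.2)).finrank_eq]

theorem ncard_le_pow_of_subset_Icc {A B : Submodule F V} {S : Set (Submodule F V)} {e : ℕ}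
    (hS : S ⊆ Set.Icc A B)
    (he : ∀ U ∈ S, (finrank F U - finrank F A) * (finrank F B - finrank F U) ≤ e) :
    S.ncard ≤ Nat.card F ^ (2 * finrank F V + e) := by
  have hq : 1 < Nat.card F := Finite.one_lt_card
  rw [two_mul, add_assoc]
  refine ncard_le_pow_add_of_fiber_le (f := fun U : Submodule F V => finrank F U) hq
    (fun U _ => Submodule.finrank_le U) fun k _ => ?_
  rcases Set.eq_empty_or_nonempty {U ∈ S | finrank F U = k} with h | ⟨U₀, hU₀, rfl⟩
  · simp [h]
  calc {U ∈ S | finrank F U = finrank F U₀}.ncard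
      ≤ (Set.Icc A B ∩ grassmannian F V (finrank F U₀)).ncard :=
        Set.ncard_le_ncard fun U hU => ⟨hS hU.1, hU.2⟩
    _ ≤ _ := ncard_Icc_inter_grassmannian_le _ _ _
    _ ≤ _ := Nat.pow_le_pow_right (by omega) (by rw [mul_add_one]; have := he U₀ hU₀; omega)

/-- Choose `U ⊓ A` inside `A` first, and then `U` above it. -/
theorem ncard_grassmannian_finrank_inf_eq_le (A : Submodule F V) (m i : ℕ) :
    {U ∈ grassmannian F V m | finrank F ↥(U ⊓ A) = i}.ncard ≤
      Nat.card F ^ ((m - i) * (finrank F V - m + 1)) *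
        Nat.card F ^ (i * (finrank F A - i + 1)) := by
  have hfiber (I) (hI : I ∈ Set.Icc ⊥ A ∩ grassmannian F V i) :
      {U ∈ {U ∈ grassmannian F V m | finrank F ↥(U ⊓ A) = i} | U ⊓ A = I}.ncard ≤
        Nat.card F ^ ((m - i) * (finrank F V - m + 1)) := by
    refine (Set.ncard_le_ncard ?_).trans ((ncard_Ici_inter_grassmannian_le I m).trans_eq ?_)
    · rintro U ⟨⟨hU, -⟩, rfl⟩
      exact ⟨Set.mem_Ici.2 inf_le_left, hU⟩
    · rw [show finrank F I = i from hI.2]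
  have hmaps : Set.MapsTo (· ⊓ A) {U ∈ grassmannian F V m | finrank F ↥(U ⊓ A) = i}
      (Set.Icc ⊥ A ∩ grassmannian F V i) := fun U hU => ⟨⟨bot_le, inf_le_right⟩, hU.2⟩
  refine (ncard_le_mul_ncard_of_mapsTo (Set.toFinite _) hmaps hfiber).trans
    (Nat.mul_le_mul_left _ ?_)
  simpa using ncard_Icc_inter_grassmannian_le ⊥ A i

end Counting

section Distance

variable {F : Type*} [Field F] {n : ℕ} {U V : ProjSpace F n}

theorem subspaceDist_add_two_mul_finrank_inf (U V : ProjSpace F n) :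
    subspaceDist U V + 2 * finrank F ↥(U ⊓ V) = finrank F U + finrank F V := by
  have hdim := Submodule.finrank_sup_add_finrank_inf_eq U V
  have hle := Submodule.finrank_mono (R := F) (inf_le_sup : U ⊓ V ≤ U ⊔ V)
  rw [subspaceDist]
  omega

theorem subspaceDist_comm (U V : ProjSpace F n) : subspaceDist U V = subspaceDist V U := by
  rw [subspaceDist, subspaceDist, sup_comm, inf_comm]

theorem subspaceDist_of_le (h : U ≤ V) : subspaceDist U V = finrank F V - finrank F U := by
  rw [subspaceDist, sup_eq_right.2 h, inf_eq_left.2 h]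

theorem exists_ge_subspaceDist_le {W : ProjSpace F n} {ρ : ℕ} (hW : finrank F W ≤ ρ)
    (U : ProjSpace F n) :
    ∃ V, W ≤ V ∧ finrank F V = min (finrank F U + ρ) n ∧ subspaceDist U V ≤ ρ := by
  have hsup := Submodule.finrank_add_le_finrank_add_finrank U W
  have hle := Submodule.finrank_le (U ⊔ W)
  rw [finrank_fin_fun] at hle
  obtain ⟨V, hUWV, -, hV⟩ := exists_finrank_eq_between (F := F) (A := U ⊔ W) (B := ⊤) le_top
    (d := min (finrank F U + ρ) n) (by omega) (by simp)
  refine ⟨V, le_sup_right.trans hUWV, hV, ?_⟩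
  rw [subspaceDist_of_le (le_sup_left.trans hUWV)]
  omega

theorem exists_le_subspaceDist_le {H : ProjSpace F n} {ρ : ℕ} (hH : n ≤ finrank F H + ρ)
    (U : ProjSpace F n) :
    ∃ V, V ≤ H ∧ finrank F V = finrank F U - ρ ∧ subspaceDist U V ≤ ρ := by
  have hdim := Submodule.finrank_sup_add_finrank_inf_eq U H
  have hle := Submodule.finrank_le (U ⊔ H)
  rw [finrank_fin_fun] at hle
  obtain ⟨V, -, hVUH, hV⟩ := exists_finrank_eq_between (F := F) (A := ⊥) (B := U ⊓ H) bot_le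
    (d := finrank F U - ρ) (by simp) (by omega)
  refine ⟨V, hVUH.trans inf_le_right, hV, ?_⟩
  rw [subspaceDist_comm, subspaceDist_of_le (hVUH.trans inf_le_left)]
  omega

end Distance

section MinCoveringCard

variable {F : Type*} [Field F] [Finite F] {n : ℕ}

theorem coveringRadius_le_iff {C : Set (ProjSpace F n)} (hC : C.Nonempty) {ρ : ℕ} :
    coveringRadius C ≤ ρ ↔ ∀ U, ∃ V ∈ C, subspaceDist U V ≤ ρ := by
  have := hC.to_subtype
  have hdist (U : ProjSpace F n) : distToCode U C ≤ ρ ↔ ∃ V ∈ C, subspaceDist U V ≤ ρ := by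
    constructor
    · intro h
      obtain ⟨V, hV⟩ := ciInf_mem fun V : C => subspaceDist U (V : ProjSpace F n)
      exact ⟨V, V.2, hV.trans_le h⟩
    · rintro ⟨V, hV, h⟩
      exact (ciInf_le (OrderBot.bddBelow _) (⟨V, hV⟩ : C)).trans h
  rw [coveringRadius, ciSup_le_iff (Set.finite_range _).bddAbove]
  exact forall_congr' hdist

theorem minCoveringCard_le_ncard {C : Set (ProjSpace F n)} (hC : C.Nonempty) {ρ : ℕ}
    (hcover : ∀ U, ∃ V ∈ C, subspaceDist U V ≤ ρ) : minCoveringCard F n ρ ≤ C.ncard :=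
  Nat.sInf_le ⟨C, hC, (coveringRadius_le_iff hC).2 hcover, rfl⟩

variable (F n) in
theorem exists_code_ncard_eq_minCoveringCard (ρ : ℕ) :
    ∃ C : Set (ProjSpace F n), C.Nonempty ∧ (∀ U, ∃ V ∈ C, subspaceDist U V ≤ ρ) ∧
      C.ncard = minCoveringCard F n ρ := by
  have huniv : coveringRadius (Set.univ : Set (ProjSpace F n)) ≤ ρ :=
    (coveringRadius_le_iff Set.univ_nonempty).2 fun U =>
      ⟨U, trivial, by simp [subspaceDist_of_le le_rfl]⟩
  have hne : {m : ℕ | ∃ C : Set (ProjSpace F n),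
      C.Nonempty ∧ coveringRadius C ≤ ρ ∧ C.ncard = m}.Nonempty :=
    ⟨_, Set.univ, Set.univ_nonempty, huniv, rfl⟩
  obtain ⟨C, hC, hρ, hcard⟩ := Nat.sInf_mem hne
  exact ⟨C, hC, (coveringRadius_le_iff hC).1 hρ, hcard⟩

variable (F n) in
theorem minCoveringCard_pos (ρ : ℕ) : 0 < minCoveringCard F n ρ := by
  obtain ⟨C, hC, -, hcard⟩ := exists_code_ncard_eq_minCoveringCard F n ρ
  exact hcard ▸ hC.ncard_pos

theorem minCoveringCard_le_two {ρ : ℕ} (h : n ≤ 2 * ρ + 1) : minCoveringCard F n ρ ≤ 2 := by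
  refine (minCoveringCard_le_ncard (C := {⊥, ⊤}) (by simp) fun U => ?_).trans
    ((Set.ncard_insert_le _ _).trans_eq (by rw [Set.ncard_singleton]))
  rcases le_or_gt (finrank F U) ρ with hU | hU
  · refine ⟨⊥, by simp, ?_⟩
    simpa [subspaceDist_comm U, subspaceDist_of_le bot_le] using hU
  · refine ⟨⊤, by simp, ?_⟩
    rw [subspaceDist_of_le le_top, finrank_top, finrank_fin_fun]
    omega

theorem mul_sub_sub_le_div_four {n ρ d : ℕ} (h : 2 * d + 2 * ρ ≤ n) :
    d * (n - ρ - d) ≤ n * (n - 2 * ρ) / 4 := by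
  rw [Nat.le_div_iff_mul_le (by norm_num)]
  zify [show d ≤ n - ρ by omega, show ρ ≤ n by omega, show 2 * ρ ≤ n by omega] at h ⊢
  nlinarith [mul_nonneg (show (0 : ℤ) ≤ n - 2 * d by omega)
    (show (0 : ℤ) ≤ n - 2 * ρ - 2 * d by omega)]

theorem ncard_Ici_half_add_le_finrank_le {W : ProjSpace F n} {ρ : ℕ} (hW : finrank F W = ρ) :
    {V | W ≤ V ∧ n + 2 * ρ ≤ 2 * finrank F V}.ncard ≤
      Nat.card F ^ (2 * n + n * (n - 2 * ρ) / 4) := by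
  have hdim (V : ProjSpace F n) (hV : n + 2 * ρ ≤ 2 * finrank F V) :
      (finrank F V - finrank F W) * (finrank F (⊤ : ProjSpace F n) - finrank F V) ≤
        n * (n - 2 * ρ) / 4 := by
    have hVn := Submodule.finrank_le V
    rw [finrank_fin_fun] at hVn
    have := mul_sub_sub_le_div_four (n := n) (ρ := ρ) (d := n - finrank F V) (by omega)
    rwa [finrank_top, finrank_fin_fun, hW, mul_comm,
      show finrank F V - ρ = n - ρ - (n - finrank F V) by omega]
  have hsub : {V | W ≤ V ∧ n + 2 * ρ ≤ 2 * finrank F V} ⊆ Set.Icc W ⊤ :=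
    fun V hV => ⟨hV.1, le_top⟩
  simpa using ncard_le_pow_of_subset_Icc hsub fun V hV => hdim V hV.2

theorem ncard_Iic_finrank_le_half_sub_le {H : ProjSpace F n} {ρ : ℕ}
    (hH : finrank F H = n - ρ) :
    {V | V ≤ H ∧ 2 * finrank F V + 2 * ρ ≤ n}.ncard ≤
      Nat.card F ^ (2 * n + n * (n - 2 * ρ) / 4) := by
  have hdim (V : ProjSpace F n) (hV : 2 * finrank F V + 2 * ρ ≤ n) :
      (finrank F V - finrank F (⊥ : ProjSpace F n)) * (finrank F H - finrank F V) ≤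
        n * (n - 2 * ρ) / 4 := by
    rw [finrank_bot, Nat.sub_zero, hH]
    exact mul_sub_sub_le_div_four hV
  have hsub : {V | V ≤ H ∧ 2 * finrank F V + 2 * ρ ≤ n} ⊆ Set.Icc ⊥ H :=
    fun V hV => ⟨bot_le, hV.1⟩
  simpa using ncard_le_pow_of_subset_Icc hsub fun V hV => hdim V hV.2

variable (F n) in
theorem minCoveringCard_le_pow (ρ : ℕ) :
    minCoveringCard F n ρ ≤ Nat.card F ^ (1 + (2 * n + n * (n - 2 * ρ) / 4)) := by
  have hq : 1 < Nat.card F := Finite.one_lt_card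
  rcases le_total n (2 * ρ) with hρ | hρ
  · calc minCoveringCard F n ρ ≤ 2 := minCoveringCard_le_two (by omega)
      _ ≤ Nat.card F ^ 1 := by rwa [pow_one]
      _ ≤ _ := Nat.pow_le_pow_right (by omega) (by omega)
  have hex (d : ℕ) (hd : d ≤ n) : ∃ U : ProjSpace F n, finrank F U = d := by
    obtain ⟨U, -, -, hU⟩ := exists_finrank_eq_between (F := F) (V := Fin n → F) (A := ⊥) (B := ⊤)
      bot_le (d := d) (by simp) (by simpa using hd)
    exact ⟨U, hU⟩
  obtain ⟨W, hW⟩ := hex ρ (by omega)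
  obtain ⟨H, hH⟩ := hex (n - ρ) (by omega)
  set above : Set (ProjSpace F n) := {V | W ≤ V ∧ n + 2 * ρ ≤ 2 * finrank F V}
  set below : Set (ProjSpace F n) := {V | V ≤ H ∧ 2 * finrank F V + 2 * ρ ≤ n}
  have hcover (U : ProjSpace F n) : ∃ V ∈ above ∪ below, subspaceDist U V ≤ ρ := by
    rcases le_total n (2 * finrank F U) with hU | hU
    · obtain ⟨V, hWV, hV, hUV⟩ := exists_ge_subspaceDist_le hW.le U
      exact ⟨V, .inl ⟨hWV, by omega⟩, hUV⟩
    · obtain ⟨V, hVH, hV, hUV⟩ := exists_le_subspaceDist_le (ρ := ρ) (H := H) (by omega) U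
      exact ⟨V, .inr ⟨hVH, by omega⟩, hUV⟩
  have hne : (above ∪ below).Nonempty := let ⟨V, hV, _⟩ := hcover ⊥; ⟨V, hV⟩
  calc minCoveringCard F n ρ ≤ (above ∪ below).ncard := minCoveringCard_le_ncard hne hcover
    _ ≤ above.ncard + below.ncard := Set.ncard_union_le _ _
    _ ≤ 2 * Nat.card F ^ (2 * n + n * (n - 2 * ρ) / 4) := by
      rw [two_mul]
      exact add_le_add (ncard_Ici_half_add_le_finrank_le hW) (ncard_Iic_finrank_le_half_sub_le hH)
    _ ≤ _ := by rw [pow_add _ 1, pow_one]; exact Nat.mul_le_mul_right _ hq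

theorem ncard_grassmannian_subspaceDist_le {m : ℕ} (hm : 2 * m ≤ n) (V : ProjSpace F n) (ρ : ℕ) :
    {U ∈ grassmannian F (Fin n → F) m | subspaceDist U V ≤ ρ}.ncard ≤
      Nat.card F ^ (2 * m + (n - m) * ρ) := by
  have hq : 1 < Nat.card F := Finite.one_lt_card
  rw [two_mul, add_assoc]
  refine ncard_le_pow_add_of_fiber_le (f := fun U => finrank F ↥(U ⊓ V)) hq
    (fun U hU => (Submodule.finrank_mono inf_le_left).trans_eq hU.1) fun i hi => ?_
  rcases Set.eq_empty_or_nonempty {U ∈ {U ∈ grassmannian F (Fin n → F) m | subspaceDist U V ≤ ρ} |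
    finrank F ↥(U ⊓ V) = i} with h | ⟨U₀, ⟨hU₀, hdist⟩, hinf⟩
  · rw [h, Set.ncard_empty]
    exact Nat.zero_le _
  have hradius : (m - i) + (finrank F V - i) ≤ ρ := by
    have := subspaceDist_add_two_mul_finrank_inf U₀ V
    have : finrank F U₀ = m := hU₀
    have := Submodule.finrank_mono (R := F) (inf_le_right : U₀ ⊓ V ≤ V)
    omega
  have hexp : (m - i) * (n - m + 1) + i * (finrank F V - i + 1) ≤ m + (n - m) * ρ := by
    calc (m - i) * (n - m + 1) + i * (finrank F V - i + 1)
        = (m - i + i) + ((m - i) * (n - m) + i * (finrank F V - i)) := by ring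
      _ ≤ m + ((m - i) * (n - m) + (n - m) * (finrank F V - i)) := by gcongr <;> omega
      _ = m + (n - m) * ((m - i) + (finrank F V - i)) := by ring
      _ ≤ m + (n - m) * ρ := by gcongr
  refine (Set.ncard_le_ncard
    (t := {U ∈ grassmannian F (Fin n → F) m | finrank F ↥(U ⊓ V) = i})
      fun U hU => ⟨hU.1.1, hU.2⟩).trans
    ((ncard_grassmannian_finrank_inf_eq_le V m i).trans ?_)
  rw [finrank_fin_fun, ← pow_add]
  exact Nat.pow_le_pow_right (by omega) hexp

theorem pow_le_minCoveringCard_mul_pow {m : ℕ} (hm : 2 * m ≤ n) (ρ : ℕ) :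
    Nat.card F ^ (m * (n - m)) ≤
      minCoveringCard F n ρ * Nat.card F ^ (2 * m + (n - m) * ρ) := by
  obtain ⟨C, -, hC, hcard⟩ := exists_code_ncard_eq_minCoveringCard F n ρ
  choose center hcenter hdist using hC
  have hball (V) (_ : V ∈ C) : {U ∈ grassmannian F (Fin n → F) m | center U = V}.ncard ≤
      Nat.card F ^ (2 * m + (n - m) * ρ) := by
    refine (Set.ncard_le_ncard ?_).trans (ncard_grassmannian_subspaceDist_le hm V ρ)
    rintro U ⟨hU, rfl⟩
    exact ⟨hU, hdist U⟩
  calc Nat.card F ^ (m * (n - m)) ≤ (grassmannian F (Fin n → F) m).ncard := by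
        simpa using pow_le_ncard_grassmannian (F := F) (V := Fin n → F) (k := m)
          (by rw [finrank_fin_fun]; omega)
    _ ≤ Nat.card F ^ (2 * m + (n - m) * ρ) * C.ncard :=
        ncard_le_mul_ncard_of_mapsTo C.toFinite (fun U _ => hcenter U) hball
    _ = _ := by rw [hcard, mul_comm]

end MinCoveringCard

section CardProjSpace

variable (F : Type*) [Field F] [Finite F]

theorem card_projSpace_le_pow (n : ℕ) :
    Nat.card (ProjSpace F n) ≤ Nat.card F ^ (2 * n + n ^ 2 / 4) := by
  have hdim (U : ProjSpace F n) : finrank F U * (n - finrank F U) ≤ n ^ 2 / 4 := by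
    have hU := Submodule.finrank_le U
    rw [finrank_fin_fun] at hU
    rw [Nat.le_div_iff_mul_le (by norm_num), mul_comm]
    simpa [← mul_assoc, Nat.add_sub_cancel' hU] using
      four_mul_le_sq_add (finrank F U) (n - finrank F U)
  have hcard := ncard_le_pow_of_subset_Icc (S := (Set.univ : Set (ProjSpace F n))) (A := ⊥) (B := ⊤)
    (e := n ^ 2 / 4) (by simp) (by simpa using hdim)
  rwa [Set.ncard_univ, finrank_fin_fun] at hcard

theorem pow_le_card_projSpace {m n : ℕ} (h : m ≤ n) :
    Nat.card F ^ (m * (n - m)) ≤ Nat.card (ProjSpace F n) := by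
  have hgrass := pow_le_ncard_grassmannian (F := F) (V := Fin n → F) (k := m) (by simpa using h)
  rw [finrank_fin_fun] at hgrass
  exact hgrass.trans (Set.ncard_le_card _)

end CardProjSpace

section Asymptotics

theorem tendsto_div_sq_of_abs_sub_le {u : ℕ → ℝ} {c K : ℝ}
    (h : ∀ n : ℕ, |u n - c * (n : ℝ) ^ 2| ≤ K * (n + 1)) :
    Tendsto (fun n : ℕ => u n / (n : ℝ) ^ 2) atTop (𝓝 c) := by
  have hlim : Tendsto (fun n : ℕ => K * (1 / (n : ℝ) + 1 / (n : ℝ) * (1 / (n : ℝ)))) atTop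
      (𝓝 0) := by
    have h0 := tendsto_one_div_atTop_nhds_zero_nat (𝕜 := ℝ)
    simpa using (h0.add (h0.mul h0)).const_mul K
  rw [tendsto_iff_norm_sub_tendsto_zero]
  refine squeeze_zero' (.of_forall fun _ => norm_nonneg _) ?_ hlim
  filter_upwards [eventually_gt_atTop 0] with n hn
  have hn' : (0 : ℝ) < n := Nat.cast_pos.2 hn
  calc ‖u n / (n : ℝ) ^ 2 - c‖ = |u n - c * (n : ℝ) ^ 2| / (n : ℝ) ^ 2 := by
        rw [Real.norm_eq_abs, ← abs_of_pos (pow_pos hn' 2), ← abs_div, abs_of_pos (pow_pos hn' 2)]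
        congr 1
        field_simp
    _ ≤ K * (n + 1) / (n : ℝ) ^ 2 := by gcongr; exact h n
    _ = _ := by field_simp

theorem logb_natCast_le_of_le_pow {b a e : ℕ} (hb : 1 < b) (ha : 0 < a) (h : a ≤ b ^ e) :
    Real.logb b a ≤ e := by
  rw [Real.logb_le_iff_le_rpow (Nat.one_lt_cast.2 hb) (Nat.cast_pos.2 ha), Real.rpow_natCast]
  exact_mod_cast h

theorem le_logb_natCast_add_of_pow_le_mul_pow {b a d e : ℕ} (hb : 1 < b) (ha : 0 < a)
    (h : b ^ d ≤ a * b ^ e) : (d : ℝ) ≤ Real.logb b a + e := by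
  have hb' : (1 : ℝ) < b := Nat.one_lt_cast.2 hb
  have hb0 : (b : ℝ) ^ e ≠ 0 := by positivity
  calc (d : ℝ) = Real.logb b ((b : ℝ) ^ d) := by
        rw [Real.logb_pow, Real.logb_self_eq_one hb', mul_one]
    _ ≤ Real.logb b (a * (b : ℝ) ^ e) :=
      Real.logb_le_logb_of_le hb' (by positivity) (by exact_mod_cast h)
    _ = Real.logb b a + e := by
      rw [Real.logb_mul (by positivity) hb0, Real.logb_pow, Real.logb_self_eq_one hb', mul_one]

theorem sq_sub_one_div_four_le_half_mul_sub_half (n : ℕ) :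
    ((n : ℝ) ^ 2 - 1) / 4 ≤ ((n / 2 * (n - n / 2) : ℕ) : ℝ) := by
  rcases Nat.even_or_odd' n with ⟨k, rfl | rfl⟩
  · rw [show 2 * k / 2 = k by omega, show 2 * k - k = k by omega]
    push_cast
    linarith
  · rw [show (2 * k + 1) / 2 = k by omega, show 2 * k + 1 - k = k + 1 by omega]
    push_cast
    linarith

variable (F : Type*) [Field F] [Finite F]

theorem abs_logb_card_projSpace_sub_le (n : ℕ) :
    |Real.logb (Nat.card F) (Nat.card (ProjSpace F n)) - 1 / 4 * (n : ℝ) ^ 2| ≤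
      2 * ((n : ℝ) + 1) := by
  have hq : 1 < Nat.card F := Finite.one_lt_card
  have hupper := logb_natCast_le_of_le_pow hq Nat.card_pos (card_projSpace_le_pow F n)
  have hlower := le_logb_natCast_add_of_pow_le_mul_pow (e := 0) hq
    (Nat.card_pos (α := ProjSpace F n))
    ((pow_le_card_projSpace F (Nat.div_le_self n 2)).trans_eq (by simp))
  have hhalf := sq_sub_one_div_four_le_half_mul_sub_half n
  have hfloor : ((n ^ 2 / 4 : ℕ) : ℝ) ≤ ((n ^ 2 : ℕ) : ℝ) / 4 := Nat.cast_div_le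
  push_cast at hupper hlower hhalf hfloor
  rw [abs_le]
  constructor <;> linarith [n.cast_nonneg (α := ℝ)]

theorem logb_minCoveringCard_le (n ρ : ℕ) :
    Real.logb (Nat.card F) (minCoveringCard F n ρ) ≤
      1 + 2 * n + n * max ((n : ℝ) - 2 * ρ) 0 / 4 := by
  have hlog := logb_natCast_le_of_le_pow Finite.one_lt_card (minCoveringCard_pos F n ρ)
    (minCoveringCard_le_pow F n ρ)
  have hfloor : ((n * (n - 2 * ρ) / 4 : ℕ) : ℝ) ≤ ((n * (n - 2 * ρ) : ℕ) : ℝ) / 4 :=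
    Nat.cast_div_le
  have hsub : ((n - 2 * ρ : ℕ) : ℝ) = max ((n : ℝ) - 2 * ρ) 0 := by
    rcases le_total (2 * ρ) n with h | h
    · rw [Nat.cast_sub h, Nat.cast_mul, Nat.cast_ofNat,
        max_eq_left (sub_nonneg.2 (by exact_mod_cast h))]
    · rw [Nat.sub_eq_zero_of_le h, Nat.cast_zero,
        max_eq_right (sub_nonpos.2 (by exact_mod_cast h))]
  rw [Nat.cast_mul, hsub] at hfloor
  push_cast at hlog
  linarith

theorem le_logb_minCoveringCard (n ρ : ℕ) :
    ((n : ℝ) ^ 2 - 1) / 4 - n - (n + 1) / 2 * ρ ≤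
      Real.logb (Nat.card F) (minCoveringCard F n ρ) := by
  have hlog := le_logb_natCast_add_of_pow_le_mul_pow Finite.one_lt_card
    (minCoveringCard_pos F n ρ) (pow_le_minCoveringCard_mul_pow (m := n / 2) (by omega) ρ)
  have hhalf := sq_sub_one_div_four_le_half_mul_sub_half n
  have hexp : 2 * (2 * (n / 2) + (n - n / 2) * ρ) ≤ 2 * n + (n + 1) * ρ := by
    nlinarith [Nat.mul_le_mul_right ρ (show 2 * (n - n / 2) ≤ n + 1 by omega),
      Nat.div_mul_le_self n 2]
  have hexp' : 2 * ((2 * (n / 2) + (n - n / 2) * ρ : ℕ) : ℝ) ≤ 2 * n + (n + 1) * ρ := by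
    exact_mod_cast hexp
  linarith

theorem abs_logb_minCoveringCard_sub_le {ρ' : ℝ} (hρ' : 0 ≤ ρ') (n : ℕ) :
    |Real.logb (Nat.card F) (minCoveringCard F n ⌊(n : ℝ) * ρ'⌋₊) -
      max (1 - 2 * ρ') 0 / 4 * (n : ℝ) ^ 2| ≤ (3 + ρ') * ((n : ℝ) + 1) := by
  have hn : (0 : ℝ) ≤ n := n.cast_nonneg
  set ρ := ⌊(n : ℝ) * ρ'⌋₊
  have hρ_le : (ρ : ℝ) ≤ n * ρ' := Nat.floor_le (by positivity)
  have hlt_ρ : n * ρ' < (ρ : ℝ) + 1 := Nat.lt_floor_add_one _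
  have hmax : max ((n : ℝ) - 2 * ρ) 0 ≤ n * max (1 - 2 * ρ') 0 + 2 := by
    refine max_le ?_ (by positivity)
    nlinarith [mul_le_mul_of_nonneg_left (le_max_left (1 - 2 * ρ') 0) hn]
  have hupper := logb_minCoveringCard_le F n ρ
  have hlower := le_logb_minCoveringCard F n ρ
  have hnonneg : 0 ≤ Real.logb (Nat.card F) (minCoveringCard F n ρ) :=
    Real.logb_nonneg (Nat.one_lt_cast.2 Finite.one_lt_card)
      (Nat.one_le_cast.2 (minCoveringCard_pos F n ρ))
  rw [abs_le]
  constructor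
  · rcases le_total (1 - 2 * ρ') 0 with h | h
    · rw [max_eq_right h]
      nlinarith [mul_nonneg hρ' hn]
    · rw [max_eq_left h]
      nlinarith [mul_le_mul_of_nonneg_left hρ_le (show (0 : ℝ) ≤ (n + 1) / 2 by positivity)]
  · nlinarith [mul_le_mul_of_nonneg_left hmax hn, mul_nonneg hρ' hn]

end Asymptotics

end SubspaceCode

open Filter Topology SubspaceCode in
theorem mainTheorem5_general (F : Type*) [Field F] [Finite F] {ρ' : ℝ} (hρ' : 0 ≤ ρ') :
    Tendsto (fun n : ℕ => Real.logb (Nat.card F) (minCoveringCard F n ⌊(n : ℝ) * ρ'⌋₊) /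
      Real.logb (Nat.card F) (Nat.card (ProjSpace F n))) atTop (𝓝 (max (1 - 2 * ρ') 0)) := by
  have hnum := tendsto_div_sq_of_abs_sub_le (abs_logb_minCoveringCard_sub_le F hρ')
  have hden := tendsto_div_sq_of_abs_sub_le (abs_logb_card_projSpace_sub_le F)
  have hquot := hnum.div hden (by norm_num)
  rw [div_div_div_cancel_right₀ (by norm_num), div_one] at hquot
  refine hquot.congr' ?_
  filter_upwards [eventually_ne_atTop 0] with n hn
  exact div_div_div_cancel_right₀ (by positivity) _ _

theorem mainTheorem5 (F : Type*) [Field F] [Finite F] :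
    (∀ ρ' : ℝ, 0 ≤ ρ' → ρ' ≤ 1 / 2 →
      SubspaceCode.coveringRate F ρ' = ((1 - 2 * ρ' : ℝ) : EReal)) ∧
    (∀ ρ' : ℝ, 1 / 2 ≤ ρ' → SubspaceCode.coveringRate F ρ' = 0) := by
  have hrate {ρ' : ℝ} (hρ' : 0 ≤ ρ') :
      SubspaceCode.coveringRate F ρ' = (max (1 - 2 * ρ') 0 : ℝ) :=
    (EReal.tendsto_coe.2 (mainTheorem5_general F hρ')).liminf_eq
  refine ⟨fun ρ' h0 h1 => ?_, fun ρ' h => ?_⟩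
  · rw [hrate h0, max_eq_left (by linarith)]
  · rw [hrate (by linarith), max_eq_right (by linarith), EReal.coe_zero]
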